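/- A line of random length, exponentially distributed with mean $1/\beta$, is walked from its start, and relays are placed on the way. Let $\beta>0$, $\rho>0$, and let $\xi>0$ be the cost of a relay. The resulting total-cost Markov decision process has the states $(0,1]\cup\{\mathbf{EOL}\}$, where $\mathbf{EOL}$ (end of line) is absorbing and free of cost, and the actions $[0,\infty]$ (the distance to the next relay; $\infty$ means that no further relay is placed). In a state $s\in(0,1]$, under the action $a$ and with residual line length $l$, the single-stage cost is $$c(s,a,l)=\begin{cases}\xi+s(e^{\rho a}-1), & l>a,\\ s(e^{\rho l}-1), & l\le a,\end{cases}$$ and the next state is $\dfrac{se^{\rho a}}{1+se^{\rho a}}$, with residual length $l-a$, if $l>a$, and $\mathbf{EOL}$ otherwise. A policy $\pi$ is a sequence of measurable maps $\mu_1,\mu_2,\dots$ from $(0,1]$ to $[0,\infty]$, one for each decision instant, giving the action as a function of the current state. At a decision instant $k$ with $s_k=s\in(0,1]$ the residual length $l_k$ is exponentially distributed with mean $1/\beta$. Let $$V^\pi_\xi(s)=\mathbb{E}_\pi\Big(\sum_{n=k}^\infty c(s_n,a_n,l_n)\,\Big|\,s_k=s\Big)\in[0,\infty],\qquad J_\xi(s)=\inf_\pi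 V^\pi_\xi(s).$$ Then for every $0<a<\infty$ and every $s\in(0,1]$, $$J_\xi(s)<\frac{1}{\beta a}\left(\xi+(e^{\rho a}-1)\right)+(e^{\rho a}-1).$$ Moreover, the policy that always places the next relay at the distance $a$ has an expected cost-to-go $V^\pi_\xi(s)$ that satisfies the same strict bound. -/

import Mathlib

open MeasureTheory ProbabilityTheory
open scoped ENNReal

noncomputable section

namespace RelayMDP

/-- The state space `(0,1] ∪ {EOL}`, where `EOL` ("end of line") is the termination state. -/
inductive State : Type
  | live (s : Set.Ioc (0 : ℝ) 1) : State
  | eol : State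

/-- The action space `[0,∞) ∪ {∞}`: the distance at which the next relay is to be placed;
`∞` means that no further relay is placed. -/
abbrev Action : Type := ℝ≥0∞

/-- A deployment policy: a sequence of (Borel) mappings; the `k`-th one prescribes the action at
the `k`-th decision instant as a function of the current state. No action is taken at `EOL`. -/
structure Policy : Type where
  act : ℕ → Set.Ioc (0 : ℝ) 1 → Action
  measurable_act : ∀ k, Measurable (act k)

/-- The policy that places every next relay at the distance `a` from the current one. -/
def constantSpacing (a : ℝ) : Policy where
  act := fun _ _ => ENNReal.ofReal a
  measurable_act := fun _ => measurable_const

/-- The state `s e^{ρa} / (1 + s e^{ρa})` reached when a relay is placed at distance `a < ∞`. -/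
def relayState (ρ : ℝ) (s : Set.Ioc (0 : ℝ) 1) (a : ℝ) : Set.Ioc (0 : ℝ) 1 :=
  ⟨(s : ℝ) * Real.exp (ρ * a) / (1 + (s : ℝ) * Real.exp (ρ * a)), by
    have h : 0 < (s : ℝ) * Real.exp (ρ * a) := mul_pos s.2.1 (Real.exp_pos _)
    refine ⟨by positivity, ?_⟩
    rw [div_le_one (by positivity)]
    linarith⟩

/-- The state evolution: from the live state `s`, under action `a` and with residual length `l`
of the line, a relay is placed if `l > a`, and otherwise the line ends. -/
def nextState (ρ : ℝ) (s : Set.Ioc (0 : ℝ) 1) (a : Action) (l : ℝ) : State :=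
  if a < ENNReal.ofReal l then State.live (relayState ρ s a.toReal) else State.eol

/-- The single-stage cost `c(s,a,l)` at a live state `s`. -/
def stageCost (ρ ξ : ℝ) (s : Set.Ioc (0 : ℝ) 1) (a : Action) (l : ℝ) : ℝ :=
  if a < ENNReal.ofReal l then ξ + (s : ℝ) * (Real.exp (ρ * a.toReal) - 1)
  else (s : ℝ) * (Real.exp (ρ * l) - 1)

/-- The pair (state, residual length of the line) at the decision instant `k + n` under the
policy `π`, when the state at instant `k` is `s` and the residual length at instant `k` is `l`.
Walking the distance `a` to the next relay reduces the residual length by `a`;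
`EOL` is absorbing. -/
def path (ρ : ℝ) (π : Policy) (k : ℕ) (s : Set.Ioc (0 : ℝ) 1) (l : ℝ) : ℕ → State × ℝ
  | 0 => (State.live s, l)
  | n + 1 =>
    match path ρ π k s l n with
    | (State.live t, r) =>
      (nextState ρ t (π.act (k + n) t) r, r - (π.act (k + n) t).toReal)
    | (State.eol, r) => (State.eol, r)

/-- The cost incurred at the decision instant `k + n`; it is `0` at `EOL`. -/
def costAt (ρ ξ : ℝ) (π : Policy) (k : ℕ) (s : Set.Ioc (0 : ℝ) 1) (l : ℝ) (n : ℕ) : ℝ :=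
  match path ρ π k s l n with
  | (State.live t, r) => stageCost ρ ξ t (π.act (k + n) t) r
  | (State.eol, _) => 0

/-- The expected cost-to-go `E_π (∑_{n ≥ k} c(s_n, a_n, l_n) | s_k = s)`, a value in `[0,∞]`.
The length of the line is exponentially distributed with mean `1/β`, hence so is the residual
length `l_k` at a placement point; all costs are nonnegative. -/
def costToGo (β ρ ξ : ℝ) (π : Policy) (k : ℕ) (s : Set.Ioc (0 : ℝ) 1) : ℝ≥0∞ :=
  ∫⁻ l, ∑' n, ENNReal.ofReal (costAt ρ ξ π k s l n) ∂(expMeasure β)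

/-- The optimal value function `J_ξ(s)`: the infimum over all policies of the expected cost-to-go
from the state `s` at the decision instant `k`. -/
def optimalValue (β ρ ξ : ℝ) (k : ℕ) (s : Set.Ioc (0 : ℝ) 1) : ℝ≥0∞ :=
  ⨅ π : Policy, costToGo β ρ ξ π k s

end RelayMDP

end

namespace RelayMDP

/-! Place relays at every multiple of `a`. Stage `n` then places a relay only if `l > (n+1)a`, and
ends the line only if `na < l ≤ (n+1)a`, up to null sets. Write `E = e^{ρa} - 1` and `q = e^{-βa}`.
Since every state is at most 1, the stage costs are at most `ξ + E` and `E` on these events, whose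
probabilities are `q^{n+1}` and `q^n - q^{n+1}`. Summing the geometric series gives
`(ξ+E)/(e^{βa}-1) + E`, and `βa < e^{βa} - 1` finishes the bound; the infimum over policies can only
be smaller. -/

theorem expMeasure_Ioc {β x y : ℝ} (hβ : 0 < β) (hx : 0 ≤ x) (hxy : x ≤ y) :
    expMeasure β (Set.Ioc x y) =
      ENNReal.ofReal (Real.exp (-(β * x)) - Real.exp (-(β * y))) := by
  have := isProbabilityMeasure_expMeasure hβ
  rw [← measure_cdf (expMeasure β), StieltjesFunction.measure_Ioc, cdf_expMeasure_eq hβ,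
    cdf_expMeasure_eq hβ, if_pos hx, if_pos (hx.trans hxy)]
  congr 1
  ring

theorem expMeasure_Ioi {β x : ℝ} (hβ : 0 < β) (hx : 0 ≤ x) :
    expMeasure β (Set.Ioi x) = ENNReal.ofReal (Real.exp (-(β * x))) := by
  have := isProbabilityMeasure_expMeasure hβ
  rw [← ofReal_measureReal, ← Set.compl_Iic, probReal_compl_eq_one_sub measurableSet_Iic,
    ← cdf_eq_real, cdf_expMeasure_eq hβ, if_pos hx, sub_sub_cancel]

/-- Under constant spacing, each placement shortens the residual line by the spacing. -/
theorem path_constantSpacing_residual {ρ a : ℝ} (ha : 0 ≤ a) (k : ℕ)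
    (s : Set.Ioc (0 : ℝ) 1) (l : ℝ) (n : ℕ) {t : Set.Ioc (0 : ℝ) 1}
    (ht : (path ρ (constantSpacing a) k s l n).1 = State.live t) :
    (path ρ (constantSpacing a) k s l n).2 = l - n * a := by
  induction n generalizing t with
  | zero => simp [path]
  | succ n ih =>
    rcases hp : path ρ (constantSpacing a) k s l n with ⟨u | _, r⟩
    · have hr := ih (t := u) (by rw [hp])
      rw [hp] at hr
      simp only at hr
      simp only [path, hp]
      simp only [constantSpacing, ENNReal.toReal_ofReal ha, hr]
      push_cast
      ring
    · simp [path, hp] at ht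

/-- Replacing the state by its upper bound 1 removes the state dynamics, so the dominating cost
depends on `l` alone and can be integrated stage by stage. -/
theorem costAt_constantSpacing_le {ρ ξ a : ℝ} (hρ : 0 ≤ ρ) (ha : 0 ≤ a) (k : ℕ)
    (s : Set.Ioc (0 : ℝ) 1) (l : ℝ) (n : ℕ) :
    ENNReal.ofReal (costAt ρ ξ (constantSpacing a) k s l n) ≤
      (Set.Ioi ((n + 1 : ℝ) * a)).indicator
          (fun _ => ENNReal.ofReal (ξ + (Real.exp (ρ * a) - 1))) l +
        (Set.Ioc (n * a) ((n + 1 : ℝ) * a)).indicator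
          (fun _ => ENNReal.ofReal (Real.exp (ρ * a) - 1)) l := by
  have hres := fun t => path_constantSpacing_residual (ρ := ρ) ha k s l n (t := t)
  rcases hp : path ρ (constantSpacing a) k s l n with ⟨t | _, r⟩
  · obtain rfl : r = l - n * a := by simpa [hp] using hres t (by rw [hp])
    have ht1 : (t : ℝ) ≤ 1 := t.2.2
    have ht0 : 0 < (t : ℝ) := t.2.1
    have hE : 0 ≤ Real.exp (ρ * a) - 1 := by
      have := Real.one_le_exp (mul_nonneg hρ ha)
      linarith
    simp only [costAt, hp]
    simp only [stageCost, constantSpacing, ENNReal.toReal_ofReal ha]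
    by_cases h : a < l - n * a
    · rw [if_pos ((ENNReal.ofReal_lt_ofReal_iff_of_nonneg ha).2 h),
        Set.indicator_of_mem (by rw [Set.mem_Ioi]; linarith)]
      refine le_add_right (ENNReal.ofReal_le_ofReal ?_)
      gcongr
      exact mul_le_of_le_one_left hE ht1
    · rw [if_neg (fun h' => h ((ENNReal.ofReal_lt_ofReal_iff_of_nonneg ha).1 h'))]
      push Not at h
      by_cases h0 : 0 < l - n * a
      · rw [Set.indicator_of_mem (s := Set.Ioc _ _) ⟨by linarith, by linarith⟩]
        refine le_add_left (ENNReal.ofReal_le_ofReal ?_)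
        refine (mul_le_of_le_one_left ?_ ht1).trans ?_
        · have := Real.one_le_exp (mul_nonneg hρ h0.le)
          linarith
        · gcongr
      -- A live state with residual `≤ 0` occurs only for `n = 0` and `l ≤ 0`. Its cost is
      -- nonpositive, so `ENNReal.ofReal` truncates it to 0.
      · rw [ENNReal.ofReal_of_nonpos]
        · exact zero_le
        · refine mul_nonpos_of_nonneg_of_nonpos ht0.le ?_
          have := Real.exp_le_one_iff.2 (mul_nonpos_of_nonneg_of_nonpos hρ (not_lt.1 h0))
          linarith
  · simp [costAt, hp]

/-- The number of relays placed under constant spacing is geometric, with mean `1/(e^{βa} - 1)`. -/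
theorem costToGo_constantSpacing_le {β ρ ξ a : ℝ} (hβ : 0 < β) (hρ : 0 ≤ ρ) (hξ : 0 ≤ ξ)
    (ha : 0 < a) (k : ℕ) (s : Set.Ioc (0 : ℝ) 1) :
    costToGo β ρ ξ (constantSpacing a) k s ≤
      ENNReal.ofReal ((ξ + (Real.exp (ρ * a) - 1)) / (Real.exp (β * a) - 1) +
        (Real.exp (ρ * a) - 1)) := by
  have hE : 0 ≤ Real.exp (ρ * a) - 1 := by
    have := Real.one_le_exp (mul_nonneg hρ ha.le)
    linarith
  have hβa : 0 < β * a := mul_pos hβ ha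
  set E := Real.exp (ρ * a) - 1
  set q := Real.exp (-(β * a)) with hq
  have hq0 : 0 < q := Real.exp_pos _
  have hq1 : q < 1 := by rw [hq, Real.exp_lt_one_iff]; linarith
  have hpow (n : ℕ) : Real.exp (-(β * (n * a))) = q ^ n := by
    rw [hq, ← Real.exp_nat_mul]
    ring_nf
  -- The `n`-th term is the integral of the `n`-th dominating cost. The `E` part telescopes to `E`.
  have hsum : HasSum (fun n : ℕ => (ξ + E) * q ^ (n + 1) + E * (q ^ n - q ^ (n + 1)))
      ((ξ + E) / (Real.exp (β * a) - 1) + E) := by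
    have hval : (ξ + E) / (Real.exp (β * a) - 1) + E =
        ((ξ + E) * q + E * (1 - q)) * (1 - q)⁻¹ := by
      have h1 : 1 - q ≠ 0 := by linarith
      have h2 : Real.exp (β * a) = q⁻¹ := by rw [hq, Real.exp_neg, inv_inv]
      have h3 : q⁻¹ - 1 = (1 - q) / q := by field_simp
      rw [h2, h3]
      field_simp
    rw [hval]
    refine ((hasSum_geometric_of_lt_one hq0.le hq1).mul_left _).congr_fun fun n => ?_
    ring
  have hnn (n : ℕ) : 0 ≤ q ^ n - q ^ (n + 1) :=
    sub_nonneg.2 (pow_le_pow_of_le_one hq0.le hq1.le n.le_succ)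
  rw [← hsum.tsum_eq, ENNReal.ofReal_tsum_of_nonneg _ hsum.summable]
  · calc costToGo β ρ ξ (constantSpacing a) k s
        ≤ ∫⁻ l, ∑' n : ℕ, ((Set.Ioi ((n + 1 : ℝ) * a)).indicator
              (fun _ => ENNReal.ofReal (ξ + E)) l +
            (Set.Ioc (n * a) ((n + 1 : ℝ) * a)).indicator
              (fun _ => ENNReal.ofReal E) l) ∂(expMeasure β) :=
          lintegral_mono fun l => ENNReal.tsum_le_tsum fun n =>
            costAt_constantSpacing_le hρ ha.le k s l n
      _ = _ := by
          rw [lintegral_tsum fun n => by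
            exact ((measurable_const.indicator measurableSet_Ioi).add
              (measurable_const.indicator measurableSet_Ioc)).aemeasurable]
          refine tsum_congr fun n => ?_
          have hn : (0 : ℝ) ≤ n * a := by positivity
          have hn' : (n : ℝ) * a ≤ (n + 1) * a := by gcongr; linarith
          have hpow' : Real.exp (-(β * ((n + 1 : ℝ) * a))) = q ^ (n + 1) := by
            rw [← hpow]
            push_cast
            rfl
          rw [lintegral_add_left (measurable_const.indicator measurableSet_Ioi),
            lintegral_indicator_const measurableSet_Ioi,
            lintegral_indicator_const measurableSet_Ioc,
            expMeasure_Ioi hβ (hn.trans hn'), expMeasure_Ioc hβ hn hn', hpow, hpow',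
            ENNReal.ofReal_add (by positivity) (mul_nonneg hE (hnn n)),
            ENNReal.ofReal_mul (by positivity), ENNReal.ofReal_mul hE]
  · intro n
    have := hnn n
    positivity

end RelayMDP

theorem mainTheorem12 (β ρ ξ a : ℝ) (hβ : 0 < β) (hρ : 0 < ρ) (hξ : 0 < ξ) (ha : 0 < a)
    (k : ℕ) (s : Set.Ioc (0 : ℝ) 1) :
    RelayMDP.costToGo β ρ ξ (RelayMDP.constantSpacing a) k s
        < ENNReal.ofReal ((ξ + (Real.exp (ρ * a) - 1)) / (β * a) + (Real.exp (ρ * a) - 1)) ∧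
      RelayMDP.optimalValue β ρ ξ k s
        < ENNReal.ofReal ((ξ + (Real.exp (ρ * a) - 1)) / (β * a) + (Real.exp (ρ * a) - 1)) := by
  have hβa : 0 < β * a := mul_pos hβ ha
  have hE : 0 < Real.exp (ρ * a) - 1 := sub_pos.2 (Real.one_lt_exp_iff.2 (mul_pos hρ ha))
  -- The sole source of strictness: the numerator `ξ + E` is positive, so the smaller denominator
  -- gives a strictly larger bound.
  have hlt : β * a < Real.exp (β * a) - 1 := by
    have := Real.add_one_lt_exp hβa.ne'
    linarith
  have hcost : RelayMDP.costToGo β ρ ξ (RelayMDP.constantSpacing a) k s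
      < ENNReal.ofReal ((ξ + (Real.exp (ρ * a) - 1)) / (β * a) + (Real.exp (ρ * a) - 1)) := by
    refine (RelayMDP.costToGo_constantSpacing_le hβ hρ.le hξ.le ha k s).trans_lt ?_
    rw [ENNReal.ofReal_lt_ofReal_iff (by positivity)]
    gcongr
  exact ⟨hcost, (iInf_le _ (RelayMDP.constantSpacing a)).trans_lt hcost⟩
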